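/- An ordered field $R$ carries its order topology. Its cofinality is the smallest cardinality of an unbounded subset of $R$. For a cardinal $\kappa$ (identified with its initial ordinal), a $\kappa$-sequence in $R$ is a function $\alpha\mapsto x_\alpha$ from the set of ordinals $\alpha<\kappa$ to $R$; it is bounded if there is $M\in R$ with $|x_\alpha|\le M$ for all $\alpha$, and it converges to $L\in R$ if for every $\varepsilon>0$ in $R$ there is $\beta<\kappa$ with $|x_\alpha-L|<\varepsilon$ whenever $\beta\le\alpha<\kappa$. A $\kappa$-subsequence of $(x_\alpha)_{\alpha<\kappa}$ is a $\kappa$-sequence $(x_{g(\alpha)})_{\alpha<\kappa}$ with $g:\kappa\to\kappa$ strictly increasing. For $\kappa$ regular (in particular infinite), an ordered field of cofinality $\kappa$ has the $\kappa$-Bolzano–Weierstrass Property if every bounded $\kappa$-sequence in it has a convergent $\kappa$-subsequence. An ordered field $R$ has the Bounded Value Property if for all $a,b\in R$ and every continuous $f:[a,b]\to R$ there is $B\in R$ with $f(x)\le B$ for all $x\in[a,b]$. It is (Dedekind) complete if every nonempty subset that is bounded above has a least upper bound. (i) For every regular cardinal $\kappa$, every ordered field of cofinality $\kappa$ with the $\kappa$-Bolzano–Weierstrass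 Property has the Bounded Value Property. (ii) For every uncountable regular cardinal $\kappa$ there is an ordered field of cardinality $\kappa$ and cofinality $\kappa$ that has the $\kappa$-Bolzano–Weierstrass Property; it can be chosen to have the Bounded Value Property, to be non-Archimedean, and not to be complete. (iii) In particular, the Bounded Value Property does not imply completeness: there is a non-Archimedean ordered field of cofinality $\aleph_1$ with the $\aleph_1$-Bolzano–Weierstrass Property and the Bounded Value Property that is not complete. -/

import Mathlib

open Filter Topology Cardinal

universe u

namespace OrderedFieldAnalysis

/-- A `κ`-sequence in `R`: a function from the set of all ordinals `α < κ` to `R`, where `κ` is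
identified with its initial ordinal. -/
abbrev KappaSeq (κ : Cardinal.{u}) (R : Type u) : Type (u + 1) :=
  Set.Iio κ.ord → R

/-- A `κ`-sequence is bounded if its terms are bounded in absolute value by an element of `R`. -/
def KappaSeq.IsBounded {κ : Cardinal.{u}} {R : Type u} [Field R] [LinearOrder R]
    (x : KappaSeq κ R) : Prop :=
  ∃ M : R, ∀ α, |x α| ≤ M

/-- A `κ`-sequence is convergent if it has a limit in `R` as `α` tends to `κ`. -/
def KappaSeq.IsConvergent {κ : Cardinal.{u}} {R : Type u} [TopologicalSpace R]
    (x : KappaSeq κ R) : Prop :=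
  ∃ L : R, Tendsto x atTop (𝓝 L)

/-- `y` is a `κ`-subsequence of `x` if it is `x` read along a strictly increasing map `κ → κ`. -/
def KappaSeq.IsSubseq {κ : Cardinal.{u}} {R : Type u} (y x : KappaSeq κ R) : Prop :=
  ∃ g : Set.Iio κ.ord → Set.Iio κ.ord, StrictMono g ∧ y = x ∘ g

/-- The `κ`-Bolzano-Weierstrass Property: every bounded `κ`-sequence has a convergent
`κ`-subsequence. -/
def BolzanoWeierstrassProperty (κ : Cardinal.{u}) (R : Type u) [Field R] [LinearOrder R]
    [TopologicalSpace R] : Prop :=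
  ∀ x : KappaSeq κ R, x.IsBounded → ∃ y : KappaSeq κ R, y.IsSubseq x ∧ y.IsConvergent

/-- The Bounded Value Property: every continuous function from `[a,b]` to `R` is bounded above. -/
def BoundedValueProperty (R : Type u) [LinearOrder R] [TopologicalSpace R] : Prop :=
  ∀ (a b : R) (f : Set.Icc a b → R), Continuous f → ∃ B : R, ∀ x, f x ≤ B

/-- The Dedekind Completeness Property: every nonempty subset that is bounded above has a least
upper bound. -/
def DedekindComplete (R : Type u) [LinearOrder R] : Prop :=
  ∀ S : Set R, S.Nonempty → BddAbove S → ∃ c : R, IsLUB S c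

end OrderedFieldAnalysis

/-!
A field of cofinality `κ` contains a `κ`-sequence tending to infinity
(`exists_tendsto_atTop_of_cof_eq`). If a continuous function on `[a, b]` were unbounded, its values
would tend to infinity along a sequence in `[a, b]`, and a convergent subsequence given by the
`κ`-Bolzano-Weierstrass Property would contradict continuity at the limit
(`boundedValueProperty_of_bolzanoWeierstrassProperty`).

For an uncountable regular `κ`, the field with the Bolzano-Weierstrass Property is the field of
rational functions over `ℚ` in variables `t α`, `α < κ`, ordered so that `t α` exceeds every rational
function in the earlier variables. It is realised inside the field of Hahn series with exponents
in the colexicographically ordered group `κ →₀ ℤ`, where order and field structure come for free, as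
the subfield generated by the monomials. Its elements are quotients of series of finite support.

Let `F α` be the subfield generated by the `t β` with `β < α`. It has fewer than `κ` elements, and
for limit `α` it is the union of the earlier ones. The key algebraic fact is that an element `x` of
the big field which is bounded by an element of `F α` has a standard part in `F α`, that is, it
differs from an element of `F α` by an infinitesimal (`exists_isInfinitesimal_sub`): write `x = p / q`
with `q` of order `0` and discard from `p` and `q` all terms whose exponents involve an index that
is not below `α`. The discarded terms are infinitesimal because the exponents supported below `α`
form a convex subgroup (`ordConnected_exponentsBelow`).

Given a bounded `κ`-sequence `x`, let `c α` be the standard part of `x α` in `F α`. At limits `c` is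
regressive with respect to the filtration, so a closing-off argument, in which the uncountability of
`κ` is used, shows that `c` takes one value `b` cofinally often. The corresponding terms of `x`
converge to `b` (`bolzanoWeierstrassProperty_of_filtration`). Uncountable cofinality makes the field
non-Archimedean, hence not complete.
-/

open HahnSeries

namespace OrderedFieldAnalysis

/-! ### The Bounded Value Property, the Archimedean property and completeness -/

/-- A linear order without a largest element whose cofinality is `κ` carries a `κ`-sequence tending
to infinity: since fewer than `κ` elements are always bounded above, the `α`-th term can be chosen
above all terms with index at most `α` of an enumeration of a cofinal set. -/
theorem exists_tendsto_atTop_of_cof_eq {κ : Cardinal.{u}} (hκ : ℵ₀ ≤ κ) {R : Type u}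
    [LinearOrder R] [NoMaxOrder R] (hR : Order.cof R = κ) :
    ∃ M : KappaSeq κ R, Tendsto M atTop atTop := by
  obtain ⟨S, hS, hSκ⟩ := Order.exists_cof_eq R
  obtain ⟨e⟩ : Nonempty (κ.ord.ToType ≃ S) := by
    rw [← Cardinal.eq, hSκ, hR, Cardinal.mk_toType, Cardinal.card_ord]
  have key : ∀ α : Set.Iio κ.ord, ∃ m : R, ∀ β ≤ α, (e (Ordinal.ToType.mk β) : R) ≤ m := by
    intro α
    have hα : Order.succ α.1 < κ.ord := (Cardinal.isSuccLimit_ord hκ).succ_lt α.2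
    -- the terms of the enumeration with index at most `α` number fewer than `κ`
    have hT : ¬ IsCofinal (Set.range fun i : (Order.succ α.1).ToType =>
        (e (Ordinal.ToType.mk
          ⟨Ordinal.ToType.mk.symm i, (Ordinal.ToType.mk.symm i).2.out.trans hα⟩) : R)) := by
      intro hT
      refine ((Order.cof_le hT).trans Cardinal.mk_range_le).not_gt ?_
      rwa [hR, Cardinal.mk_toType, ← Cardinal.lt_ord]
    obtain ⟨m, hm⟩ := not_isCofinal_iff_bddAbove.1 hT
    refine ⟨m, fun β hβ =>
      hm ⟨Ordinal.ToType.mk ⟨β, Order.lt_succ_of_le (Subtype.coe_le_coe.2 hβ)⟩, ?_⟩⟩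
    simp
  choose M hM using key
  refine ⟨M, tendsto_atTop.2 fun b => ?_⟩
  obtain ⟨s, hs, hbs⟩ := hS b
  filter_upwards [Ici_mem_atTop (Ordinal.ToType.mk.symm (e.symm ⟨s, hs⟩))] with α hα
  refine hbs.trans ?_
  simpa using hM α _ hα

/-- If `f` were unbounded on `[a, b]`, choose points `x α` with `f (x α)` above the `α`-th term of a
`κ`-sequence tending to infinity. Along a convergent subsequence of `x`, the values of `f` tend both
to infinity and, by continuity, to the value of `f` at the limit. -/
theorem boundedValueProperty_of_bolzanoWeierstrassProperty {κ : Cardinal.{u}} (hκ : ℵ₀ ≤ κ)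
    {R : Type u} [Field R] [LinearOrder R] [IsStrictOrderedRing R] [TopologicalSpace R]
    [OrderTopology R] (hR : Order.cof R = κ) (hBW : BolzanoWeierstrassProperty κ R) :
    BoundedValueProperty R := by
  intro a b f hf
  by_contra! hunb
  obtain ⟨M, hM⟩ := exists_tendsto_atTop_of_cof_eq hκ hR
  choose x hx using fun α => hunb (M α)
  obtain ⟨_, ⟨g, hg, rfl⟩, L, hL⟩ := hBW (fun α => (x α : R))
    ⟨max |a| |b|, fun α => abs_le_max_abs_abs (x α).2.1 (x α).2.2⟩
  have : Nonempty (Set.Iio κ.ord) := ⟨⟨0, (Cardinal.isSuccLimit_ord hκ).bot_lt⟩⟩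
  have hLI : L ∈ Set.Icc a b := isClosed_Icc.mem_of_tendsto hL (.of_forall fun α => (x (g α)).2)
  have hxL : Tendsto (x ∘ g) atTop (𝓝 ⟨L, hLI⟩) := tendsto_subtype_rng.2 hL
  have hfin := (hf.tendsto ⟨L, hLI⟩).comp hxL
  have hinf : Tendsto (f ∘ x ∘ g) atTop atTop := by
    refine tendsto_atTop_mono (fun α => (hx (g α)).le) (hM.comp ?_)
    exact tendsto_atTop_mono (fun α => hg.le_apply) tendsto_id
  exact not_tendsto_nhds_of_tendsto_atTop hinf _ hfin

/-- If the natural numbers are bounded, they have no least upper bound `c`, because `c - 1` is again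
an upper bound. -/
theorem not_dedekindComplete_of_not_archimedean {R : Type u} [Field R] [LinearOrder R]
    [IsStrictOrderedRing R] (hR : ¬ Archimedean R) : ¬ DedekindComplete R := by
  intro h
  apply hR
  rw [archimedean_iff_nat_lt]
  by_contra! hx
  obtain ⟨x, hx⟩ := hx
  obtain ⟨c, hc⟩ := h (Set.range ((↑) : ℕ → R)) ⟨_, 0, rfl⟩ ⟨x, by rintro _ ⟨n, rfl⟩; exact hx n⟩
  have : c ≤ c - 1 := hc.2 <| by
    rintro _ ⟨n, rfl⟩
    have := hc.1 ⟨n + 1, rfl⟩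
    push_cast at this
    linarith
  linarith

theorem not_archimedean_of_aleph0_lt_cof {R : Type u} [Field R] [LinearOrder R]
    [IsStrictOrderedRing R] (hR : ℵ₀ < Order.cof R) : ¬ Archimedean R := by
  intro h
  have : IsCofinal (Set.range ((↑) : ℕ → R)) := fun x =>
    (exists_nat_ge x).imp' (↑) fun n hn => ⟨⟨n, rfl⟩, hn⟩
  refine hR.not_ge ((Order.cof_le this).trans ?_)
  exact (Set.countable_range _).le_aleph0

/-! ### A criterion for the Bolzano-Weierstrass Property -/

/-- A cofinal set of indices below the regular cardinal `κ` is enumerated increasingly by `κ`. -/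
theorem exists_strictMono_mem_of_isCofinal {κ : Cardinal.{u}} (hκ : κ.IsRegular)
    {S : Set (Set.Iio κ.ord)} (hS : IsCofinal S) :
    ∃ g : Set.Iio κ.ord → Set.Iio κ.ord, StrictMono g ∧ ∀ α, g α ∈ S := by
  have : IsRegularCardinalOrder (Set.Iio κ.ord) := ⟨by
    rw [Ordinal.cof_Iio, ← Ordinal.lift_cof, hκ.cof_ord]
    simp⟩
  exact ⟨fun α => Order.enum S hS α, fun _ _ h => (Order.enum S hS).strictMono h,
    fun α => (Order.enum S hS α).2⟩

/-- A criterion for the Bolzano-Weierstrass Property, `κ` being regular and uncountable. The field is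
the increasing union of sets `F α` of cardinality less than `κ`, continuous at limits, such that
every element bounded by an element of `F α` has a standard part in `F α`: an element of `F α` from
which it differs by less than every positive element of `F α`. If `c α ∈ F α` is the standard part
of the `α`-th term of a bounded sequence, then, as in Fodor's lemma, `c` takes some value `b`
cofinally often, and the terms with standard part `b` converge to `b`. -/
theorem bolzanoWeierstrassProperty_of_filtration {κ : Cardinal.{u}} (hκ : κ.IsRegular)
    (hκ' : ℵ₀ < κ) {R : Type u} [Field R] [LinearOrder R] [IsStrictOrderedRing R]
    [TopologicalSpace R] [OrderTopology R] (F : Ordinal.{u} → Set R) (hmono : Monotone F)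
    (hcover : ∀ x, ∃ α < κ.ord, x ∈ F α) (hcard : ∀ α < κ.ord, #(F α) < κ)
    (hcont : ∀ α, Order.IsSuccLimit α → ∀ x ∈ F α, ∃ β < α, x ∈ F β)
    (hstd : ∀ α, ∀ M ∈ F α, ∀ x, |x| ≤ M → ∃ c ∈ F α, ∀ ε ∈ F α, 0 < ε → |x - c| < ε) :
    BolzanoWeierstrassProperty κ R := by
  rintro x ⟨M, hM⟩
  obtain ⟨α₀, hα₀, hMα₀⟩ := hcover M
  have hc (α : Set.Iio κ.ord) (hα : α₀ ≤ α) :=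
    hstd α M (hmono hα hMα₀) (x α) (hM α)
  choose! c hcF hc using hc
  obtain ⟨b, hb⟩ : ∃ b : R, IsCofinal {α : Set.Iio κ.ord | α₀ ≤ α ∧ c α = b} := by
    by_contra! hcof
    simp only [not_isCofinal_iff, Set.mem_ofPred_eq] at hcof
    choose h hh using hcof
    -- `h y` bounds the indices at which `c` takes the value `y`; step from `β` to a larger index that
    -- is at least `h y` for all of the fewer than `κ` elements `y` of `F β`
    have next (β : Set.Iio κ.ord) :
        ∃ γ : Set.Iio κ.ord, β < γ ∧ ∀ y ∈ F β, h y ≤ γ := by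
      have hlim : Order.IsSuccLimit κ.ord := Cardinal.isSuccLimit_ord hκ.aleph0_le
      have hsup : ⨆ y : F β, (h y : Ordinal.{u}) < κ.ord :=
        Ordinal.iSup_lt_of_lt_cof (by rw [hκ.cof_ord]; exact hcard β β.2) fun y => (h y).2
      refine ⟨⟨max (Order.succ β) (⨆ y : F β, (h y : Ordinal.{u})),
        max_lt (hlim.succ_lt β.2) hsup⟩, ?_, fun y hy => ?_⟩
      · exact Subtype.mk_lt_mk.2 ((Order.lt_succ _).trans_le (le_max_left _ _))
      · exact (Ordinal.le_iSup (fun y : F β => (h y : Ordinal.{u})) ⟨y, hy⟩).trans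
          (le_max_right _ _)
    choose s hs hsh using next
    -- the supremum `α` of countably many steps is below `κ` since `κ` is uncountable; by continuity
    -- `c α` already lies in `F (a n)` for some `n`, which contradicts `h (c α) ≤ a (n + 1) ≤ α`
    let a : ℕ → Set.Iio κ.ord := fun n => s^[n] ⟨α₀, hα₀⟩
    have ha (n : ℕ) : a (n + 1) = s (a n) := Function.iterate_succ_apply' _ _ _
    have hamono (n : ℕ) : (a n : Ordinal.{u}) < a (n + 1) := by rw [ha]; exact hs _
    have hle (n : ℕ) : (a n : Ordinal.{u}) ≤ ⨆ n, (a n : Ordinal.{u}) :=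
      Ordinal.le_iSup (fun n => (a n : Ordinal.{u})) n
    have hlt : ⨆ n, (a n : Ordinal.{u}) < κ.ord :=
      Ordinal.lift_iSup_lt_of_lt_cof (by simpa [hκ.cof_ord] using hκ') fun n => (a n).2
    have hlim : Order.IsSuccLimit (⨆ n, (a n : Ordinal.{u})) := by
      refine ⟨?_, Order.isSuccPrelimit_of_succ_lt fun β hβ => ?_⟩
      · rw [isMin_iff_eq_bot, Ordinal.bot_eq_zero, ← ne_eq, ← pos_iff_ne_zero]
        exact (pos_of_gt (hamono 0)).trans_le (hle 1)
      · obtain ⟨n, hn⟩ := Ordinal.lt_iSup_iff.1 hβ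
        exact ((Order.succ_le_of_lt hn).trans_lt (hamono n)).trans_le (hle (n + 1))
    set α : Set.Iio κ.ord := ⟨⨆ n, (a n : Ordinal.{u}), hlt⟩ with hα
    have hα₀α : α₀ ≤ α := hle 0
    obtain ⟨β, hβ, hcβ⟩ := hcont α hlim _ (hcF α hα₀α)
    obtain ⟨n, hn⟩ := (Ordinal.lt_iSup_iff).1 hβ
    have h1 : h (c α) ≤ a (n + 1) := by
      rw [ha]; exact hsh _ _ (hmono hn.le hcβ)
    exact (hh (c α) α ⟨hα₀α, rfl⟩).not_ge (h1.trans (hle (n + 1)))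
  obtain ⟨g, hg, hgb⟩ := exists_strictMono_mem_of_isCofinal hκ hb
  refine ⟨x ∘ g, ⟨g, hg, rfl⟩, b, ?_⟩
  rw [LinearOrderedAddCommGroup.tendsto_nhds]
  intro ε hε
  obtain ⟨γ, hγ, hεγ⟩ := hcover ε
  filter_upwards [Ici_mem_atTop (⟨γ, hγ⟩ : Set.Iio κ.ord)] with α hα
  have := hc (g α) (hgb α).1 ε (hmono (show γ ≤ g α from hα.trans hg.le_apply) hεγ) hε
  rwa [(hgb α).2] at this

/-! ### Hahn series generated by monomials -/

section Hahn

variable {Γ : Type u} [AddCommGroup Γ] [LinearOrder Γ]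

/-- The Hahn series obtained from `x` by keeping only the terms with exponent in `Δ`. -/
noncomputable def restrict (Δ : AddSubgroup Γ) (x : HahnSeries Γ ℚ) : HahnSeries Γ ℚ where
  coeff := (Δ : Set Γ).indicator x.coeff
  isPWO_support' := x.isPWO_support.mono (by
    rw [Set.support_indicator]; exact Set.inter_subset_right)

theorem support_restrict (Δ : AddSubgroup Γ) (x : HahnSeries Γ ℚ) :
    (restrict Δ x).support = ↑Δ ∩ x.support :=
  Set.support_indicator

theorem support_sub_restrict (Δ : AddSubgroup Γ) (x : HahnSeries Γ ℚ) :
    (x - restrict Δ x).support = x.support \ Δ := by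
  ext g
  by_cases hg : g ∈ Δ <;> simp [restrict, hg]

theorem orderTop_le_orderTop_restrict (Δ : AddSubgroup Γ) (x : HahnSeries Γ ℚ) :
    x.orderTop ≤ (restrict Δ x).orderTop := by
  refine le_orderTop_iff_forall.2 fun g hg => ?_
  have := coeff_eq_zero_of_lt_orderTop hg
  simp [restrict, this]

/-- `x` is infinitesimal relative to `Δ` if the exponents of its terms exceed all elements of `Δ`.
Here `0`, whose `orderTop` is `⊤`, is infinitesimal. -/
def IsInfinitesimal (Δ : AddSubgroup Γ) (x : HahnSeries Γ ℚ) : Prop :=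
  ∀ δ ∈ Δ, (δ : WithTop Γ) < x.orderTop

/-- `x` is finite relative to `Δ` if the exponents of its terms are bounded below by an element of
`Δ`. -/
def IsFinite (Δ : AddSubgroup Γ) (x : HahnSeries Γ ℚ) : Prop :=
  ∃ δ ∈ Δ, (δ : WithTop Γ) ≤ x.orderTop

variable {Δ : AddSubgroup Γ} {x y : HahnSeries Γ ℚ}

theorem IsInfinitesimal.sub (hx : IsInfinitesimal Δ x) (hy : IsInfinitesimal Δ y) :
    IsInfinitesimal Δ (x - y) :=
  fun δ hδ => (lt_min (hx δ hδ) (hy δ hδ)).trans_le min_orderTop_le_orderTop_sub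

theorem isFinite_restrict (hx : IsFinite Δ x) : IsFinite Δ (restrict Δ x) :=
  hx.imp fun _ h => ⟨h.1, h.2.trans (orderTop_le_orderTop_restrict Δ x)⟩

/-- For a convex subgroup `Δ` and a finite `x`, restricting to `Δ` changes `x` only by an
infinitesimal: an exponent outside `Δ` but above an element of `Δ` lies above all of `Δ`. -/
theorem isInfinitesimal_sub_restrict (hΔ : (Δ : Set Γ).OrdConnected) (hx : IsFinite Δ x) :
    IsInfinitesimal Δ (x - restrict Δ x) := by
  obtain ⟨δ', hδ', hle⟩ := hx
  intro δ hδ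
  by_cases h0 : x - restrict Δ x = 0
  · simp [h0]
  rw [← order_eq_orderTop_of_ne_zero h0, WithTop.coe_lt_coe]
  have hmem : (x - restrict Δ x).order ∈ x.support \ (Δ : Set Γ) := by
    rw [← support_sub_restrict]; exact coeff_order_eq_zero.not.2 h0
  by_contra! hlt
  refine hmem.2 (hΔ.out hδ' hδ ⟨?_, hlt⟩)
  exact WithTop.coe_le_coe.1 (hle.trans (orderTop_le_of_coeff_ne_zero hmem.1))

variable [IsOrderedAddMonoid Γ]

theorem IsInfinitesimal.mul (hx : IsInfinitesimal Δ x) (hy : IsFinite Δ y) :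
    IsInfinitesimal Δ (x * y) := by
  obtain ⟨δ', hδ', hle⟩ := hy
  intro δ hδ
  rw [orderTop_mul]
  calc (δ : WithTop Γ) = ((δ - δ' : Γ) : WithTop Γ) + (δ' : WithTop Γ) := by
        rw [← WithTop.coe_add, sub_add_cancel]
    _ < x.orderTop + δ' := WithTop.add_lt_add_right (by simp) (hx _ (sub_mem hδ hδ'))
    _ ≤ _ := by gcongr

/-- The field of Hahn series over `ℚ` generated by the monomials with exponent in `Δ`. -/
noncomputable def monomialField (Δ : AddSubgroup Γ) : Subfield (HahnSeries Γ ℚ) :=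
  Subfield.closure ((fun g => single g (1 : ℚ)) '' Δ)

/-- The ring of Hahn series over `ℚ` with finite support contained in `Δ`, which is the group algebra
`ℚ[Δ]`. -/
def finiteSupportSubring (Δ : AddSubgroup Γ) : Subring (HahnSeries Γ ℚ) where
  carrier := {x | x.support.Finite ∧ x.support ⊆ Δ}
  zero_mem' := by simp
  one_mem' := by simp [Δ.zero_mem]
  add_mem' hx hy := ⟨(hx.1.union hy.1).subset (support_add_subset _ _),
    (support_add_subset _ _).trans (Set.union_subset hx.2 hy.2)⟩
  neg_mem' hx := by simpa using hx
  mul_mem' hx hy := ⟨(hx.1.add hy.1).subset support_mul_subset,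
    support_mul_subset.trans ((Set.add_subset_add hx.2 hy.2).trans (by simp))⟩

theorem finiteSupportSubring_le_monomialField (Δ : AddSubgroup Γ) :
    finiteSupportSubring Δ ≤ (monomialField Δ).toSubring := by
  rintro x ⟨hfin, hx⟩
  have : x = ∑ g ∈ hfin.toFinset, single (0 : Γ) (x.coeff g) * single g 1 := by
    ext a
    simp only [single_mul_single, zero_add, mul_one, coeff_sum]
    rw [Finset.sum_eq_single a]
    · simp
    · intro b _ hb
      exact coeff_single_of_ne hb.symm
    · simp
  rw [this]
  refine sum_mem fun g hg => mul_mem ?_ (Subfield.subset_closure ⟨g, hx (by simpa using hg), rfl⟩)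
  exact SubfieldClass.ratCast_mem (monomialField Δ) (x.coeff g)

theorem exists_div_of_mem_monomialField {Δ : AddSubgroup Γ} {x : HahnSeries Γ ℚ}
    (hx : x ∈ monomialField Δ) :
    ∃ p ∈ finiteSupportSubring Δ, ∃ q ∈ finiteSupportSubring Δ, p / q = x := by
  have hle : Subring.closure ((fun g => single g (1 : ℚ)) '' (Δ : Set Γ)) ≤
      finiteSupportSubring Δ := by
    rw [Subring.closure_le]
    rintro _ ⟨g, hg, rfl⟩
    constructor <;> simp_all
  obtain ⟨p, hp, q, hq, h⟩ := Subfield.mem_closure_iff.1 hx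
  exact ⟨p, hle hp, q, hle hq, h⟩

theorem order_mem_of_mem_monomialField {Δ : AddSubgroup Γ} {x : HahnSeries Γ ℚ}
    (hx : x ∈ monomialField Δ) (hx0 : x ≠ 0) : x.order ∈ Δ := by
  obtain ⟨p, hp, q, hq, rfl⟩ := exists_div_of_mem_monomialField hx
  obtain ⟨hp0, hq0⟩ := div_ne_zero_iff.1 hx0
  have h : (p / q).order + q.order = p.order := by
    rw [← order_mul hx0 hq0, div_mul_cancel₀ _ hq0]
  rw [eq_sub_of_add_eq h]
  exact sub_mem (hp.2 (by simpa using coeff_order_eq_zero.not.2 hp0))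
    (hq.2 (by simpa using coeff_order_eq_zero.not.2 hq0))

/-- An element of the field generated by all monomials is a quotient of series of finite support
whose denominator has order `0`; the last condition is achieved by multiplying numerator and
denominator by a monomial. -/
theorem exists_div_orderTop_eq_zero (hx : x ∈ monomialField ⊤) :
    ∃ p q : HahnSeries Γ ℚ, p.support.Finite ∧ q.support.Finite ∧ q.orderTop = 0 ∧
      x * q = p := by
  obtain ⟨p, hp, q, hq, rfl⟩ := exists_div_of_mem_monomialField hx
  obtain rfl | hq0 := eq_or_ne q 0
  · exact ⟨0, 1, by simp⟩
  have hs : single (-q.order) (1 : ℚ) ∈ finiteSupportSubring (⊤ : AddSubgroup Γ) := by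
    constructor <;> simp
  refine ⟨p * single (-q.order) 1, q * single (-q.order) 1, (mul_mem hp hs).1, (mul_mem hq hs).1,
    ?_, by field_simp⟩
  rw [orderTop_mul, orderTop_single one_ne_zero, ← order_eq_orderTop_of_ne_zero hq0,
    ← WithTop.coe_add, add_neg_cancel, WithTop.coe_zero]

/-- A series generated by monomials and finite relative to a convex subgroup `Δ` has a standard part
in the field generated by the monomials with exponent in `Δ`. If `x = p / q` with `q` of order `0`,
it is the quotient of the restrictions of `p` and `q` to `Δ`. -/
theorem exists_isInfinitesimal_sub (hΔ : (Δ : Set Γ).OrdConnected) (hx : x ∈ monomialField ⊤)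
    (hxΔ : IsFinite Δ x) : ∃ c ∈ monomialField Δ, IsInfinitesimal Δ (x - c) := by
  obtain ⟨p, q, hp, hq, hq0, rfl⟩ := exists_div_orderTop_eq_zero hx
  have hrestrict {y : HahnSeries Γ ℚ} (hy : y.support.Finite) : restrict Δ y ∈ monomialField Δ :=
    finiteSupportSubring_le_monomialField Δ
      ⟨hy.subset (by simp [support_restrict]), by simp [support_restrict]⟩
  have hpf : IsFinite Δ (x * q) := by
    simpa only [IsFinite, orderTop_mul, hq0, add_zero] using hxΔ
  have hqf : IsFinite Δ q := ⟨0, Δ.zero_mem, by simp [hq0]⟩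
  have hrq : (restrict Δ q).orderTop = 0 := by
    refine le_antisymm ?_ (hq0.symm.le.trans (orderTop_le_orderTop_restrict Δ q))
    apply orderTop_le_of_coeff_ne_zero (g := 0)
    simpa [restrict, Δ.zero_mem] using coeff_orderTop_ne (g := 0) hq0
  have hrq0 : restrict Δ q ≠ 0 := by
    rw [← orderTop_ne_top, hrq]; simp
  refine ⟨restrict Δ (x * q) / restrict Δ q, div_mem (hrestrict hp) (hrestrict hq), ?_⟩
  have key : (x - restrict Δ (x * q) / restrict Δ q) * q * restrict Δ q =
      (x * q - restrict Δ (x * q)) * restrict Δ q -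
        (q - restrict Δ q) * restrict Δ (x * q) := by
    field_simp
    ring
  have := ((isInfinitesimal_sub_restrict hΔ hpf).mul (isFinite_restrict hqf)).sub
    ((isInfinitesimal_sub_restrict hΔ hqf).mul (isFinite_restrict hpf))
  rw [← key] at this
  simpa only [IsInfinitesimal, orderTop_mul, hq0, hrq, add_zero] using this

end Hahn

/-! ### The ordered field generated by monomials -/

section OrderedSubfield
variable (Γ : Type u) [AddCommGroup Γ] [LinearOrder Γ] [IsOrderedAddMonoid Γ]

/-- The field generated by all monomials, with the order inherited from the lexicographic order on
Hahn series. -/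
noncomputable def orderedMonomialField : Subfield (Lex (HahnSeries Γ ℚ)) :=
  (monomialField ⊤).comap
    { toFun := ofLex
      map_one' := rfl
      map_mul' _ _ := rfl
      map_zero' := rfl
      map_add' _ _ := rfl }

variable {Γ}

/-- The elements of the ordered field that lie in the subfield generated by the monomials with
exponent in `Δ`. -/
def level (Δ : AddSubgroup Γ) : Set (orderedMonomialField Γ) :=
  {x | ofLex (x : Lex (HahnSeries Γ ℚ)) ∈ monomialField Δ}

theorem monomialField_mono : Monotone (monomialField (Γ := Γ)) :=
  fun _ _ h => Subfield.closure_mono (Set.image_mono h)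

theorem mk_level_le (Δ : AddSubgroup Γ) : #(level Δ) ≤ max #Δ ℵ₀ := by
  have h1 : #(level Δ) ≤ #(monomialField Δ) :=
    Cardinal.mk_le_of_injective (f := fun x => ⟨ofLex x.1.1, x.2⟩) fun x y h =>
      by
      exact Subtype.ext (Subtype.ext (congrArg (fun z : monomialField Δ => toLex z.1) h))
  exact h1.trans ((Subfield.cardinalMk_closure_le_max _).trans
    (max_le_max_right _ Cardinal.mk_image_le))

theorem orderTop_le_orderTop_of_abs_le_abs {x y : orderedMonomialField Γ} (h : |x| ≤ |y|) :
    (ofLex y.1).orderTop ≤ (ofLex x.1).orderTop := by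
  contrapose! h
  exact abs_lt_abs_of_orderTop_ofLex h

/-- The existence of standard parts in terms of the order: orders of nonzero elements of `level Δ`
belong to `Δ`, so that an element bounded by `level Δ` is finite relative to `Δ`, and an
infinitesimal is smaller than every positive element of `level Δ`. -/
theorem exists_mem_level_forall_abs_sub_lt {Δ : AddSubgroup Γ} (hΔ : (Δ : Set Γ).OrdConnected)
    {M x : orderedMonomialField Γ} (hM : M ∈ level Δ) (hx : |x| ≤ M) :
    ∃ c ∈ level Δ, ∀ ε ∈ level Δ, 0 < ε → |x - c| < ε := by
  have hle := orderTop_le_orderTop_of_abs_le_abs (hx.trans (le_abs_self M))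
  have hfin : IsFinite Δ (ofLex x.1) := by
    by_cases hM0 : ofLex M.1 = 0
    · exact ⟨0, Δ.zero_mem, by rw [hM0, orderTop_zero, top_le_iff] at hle; simp [hle]⟩
    · exact ⟨_, order_mem_of_mem_monomialField hM hM0,
        (order_eq_orderTop_of_ne_zero hM0).trans_le hle⟩
  obtain ⟨c, hc, hxc⟩ := exists_isInfinitesimal_sub hΔ x.2 hfin
  refine ⟨⟨toLex c, monomialField_mono le_top hc⟩, hc, fun ε hε hε0 => ?_⟩
  have hε0' : ofLex ε.1 ≠ 0 := fun h => hε0.ne' (Subtype.ext (ofLex.injective h))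
  rw [← abs_of_pos hε0]
  refine abs_lt_abs_of_orderTop_ofLex (x := x.1 - toLex c) (y := ε.1) ?_
  rw [← order_eq_orderTop_of_ne_zero hε0']
  exact hxc _ (order_mem_of_mem_monomialField hε hε0')

/-- A monomial whose exponent lies below `Δ` is infinitely large relative to `level Δ`. -/
theorem exists_forall_mem_level_lt {Δ : AddSubgroup Γ} {g : Γ} (hg : ∀ δ ∈ Δ, g < δ) :
    ∃ t : orderedMonomialField Γ, ∀ x ∈ level Δ, x < t := by
  have hg' : single g (1 : ℚ) ∈ monomialField (⊤ : AddSubgroup Γ) :=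
    Subfield.subset_closure ⟨g, trivial, rfl⟩
  have hpos : 0 < toLex (single g (1 : ℚ)) := leadingCoeff_pos_iff.1 (by simp)
  refine ⟨⟨toLex (single g 1), hg'⟩, fun x hx => lt_of_not_ge fun hle => ?_⟩
  have h0 : 0 < x.1 := hpos.trans_le hle
  have h0' : ofLex x.1 ≠ 0 := fun h => h0.ne' (ofLex.injective h)
  have := orderTop_le_orderTop_of_abs_le_abs
    (abs_le_abs_of_nonneg (Subtype.coe_le_coe.1 hpos.le) hle)
  rw [ofLex_toLex, orderTop_single one_ne_zero, ← order_eq_orderTop_of_ne_zero h0',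
    WithTop.coe_le_coe] at this
  exact this.not_gt (hg _ (order_mem_of_mem_monomialField hx h0'))

end OrderedSubfield

/-! ### The exponent group -/

section Exponents

variable (κ : Cardinal.{u})

/-- The exponents: finitely supported functions from `κ` to `ℤ`, ordered by the sign of the value at
the largest index of the support. The monomials at the negatives of the unit vectors are thus
generators indexed by `κ`, each infinitely large relative to the earlier ones. -/
abbrev ExponentGroup : Type u := Colex (κ.ord.ToType →₀ ℤ)

variable {κ}

/-- The exponents supported on the indices less than `α`. -/
def exponentsBelow (α : Ordinal.{u}) : AddSubgroup (ExponentGroup κ) where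
  carrier := {g | ∀ i : κ.ord.ToType, α ≤ Ordinal.ToType.mk.symm i → ofColex g i = 0}
  zero_mem' := fun _ _ => rfl
  add_mem' {g h} hg hh i hi := by
    change ofColex g i + ofColex h i = 0
    rw [hg i hi, hh i hi, add_zero]
  neg_mem' {g} hg i hi := by
    change -ofColex g i = 0
    rw [hg i hi, neg_zero]

theorem exponentsBelow_mono : Monotone (exponentsBelow (κ := κ)) :=
  fun _ _ h _ hg i hi => hg i (h.trans hi)

theorem exponentsBelow_ord : exponentsBelow κ.ord = (⊤ : AddSubgroup (ExponentGroup κ)) :=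
  top_unique fun _ _ i hi => absurd (Ordinal.ToType.mk.symm i).2 hi.not_gt

theorem ordConnected_exponentsBelow (α : Ordinal.{u}) :
    (exponentsBelow (κ := κ) α : Set (ExponentGroup κ)).OrdConnected := by
  refine ⟨fun δ₁ h₁ δ₂ h₂ g hg => ?_⟩
  by_contra hgα
  obtain ⟨i, hi, hgi⟩ : ∃ i, α ≤ Ordinal.ToType.mk.symm i ∧ ofColex g i ≠ 0 := by
    by_contra! h
    exact hgα h
  have hne : (ofColex g).support.Nonempty := ⟨i, by simpa using hgi⟩
  -- the sign of an element of the exponent group is decided at the largest index of its support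
  set j := (ofColex g).support.max' hne with hj
  have hgj : ofColex g j ≠ 0 := by simpa using (ofColex g).support.max'_mem hne
  have hij : i ≤ j := (ofColex g).support.le_max' i (by simpa using hgi)
  have hjα {k} (hk : j ≤ k) : α ≤ Ordinal.ToType.mk.symm k :=
    hi.trans (Ordinal.ToType.mk.symm.monotone (hij.trans hk))
  have hgk {k} (hk : j < k) : ofColex g k = 0 := by
    by_contra h
    exact hk.not_ge ((ofColex g).support.le_max' k (by simpa using h))
  rcases hgj.lt_or_gt with h | h
  · refine hg.1.not_gt (Finsupp.Colex.lt_iff.2 ⟨j, fun k hk => ?_, ?_⟩)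
    · exact (hgk hk).trans (h₁ k (hjα hk.le)).symm
    · exact h.trans_eq (h₁ j (hjα le_rfl)).symm
  · refine hg.2.not_gt (Finsupp.Colex.lt_iff.2 ⟨j, fun k hk => ?_, ?_⟩)
    · exact (h₂ k (hjα hk.le)).trans (hgk hk).symm
    · exact (h₂ j (hjα le_rfl)).trans_lt h

theorem exists_forall_mem_exponentsBelow_lt {α : Ordinal.{u}} (hα : α < κ.ord) :
    ∃ g : ExponentGroup κ, ∀ δ ∈ exponentsBelow α, g < δ := by
  refine ⟨toColex (Finsupp.single (Ordinal.ToType.mk ⟨α, hα⟩) (-1)), fun δ hδ =>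
    Finsupp.Colex.lt_iff.2 ⟨Ordinal.ToType.mk ⟨α, hα⟩, fun k hk => ?_, ?_⟩⟩
  · refine (Finsupp.single_eq_of_ne hk.ne').trans (hδ k ?_).symm
    have := Ordinal.ToType.mk.symm.monotone hk.le
    rw [OrderIso.symm_apply_apply] at this
    exact this
  · have h0 : ofColex δ (Ordinal.ToType.mk ⟨α, hα⟩) = 0 := hδ _ (by simp)
    change Finsupp.single _ (-1 : ℤ) _ < ofColex δ _
    rw [h0]
    simp

theorem mk_exponentsBelow_le (α : Ordinal.{u}) :
    #(exponentsBelow (κ := κ) α) ≤ max α.card ℵ₀ := by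
  let f : exponentsBelow (κ := κ) α →
      ({i : κ.ord.ToType | (Ordinal.ToType.mk.symm i : Ordinal.{u}) < α} →₀ ℤ) :=
    fun g => (ofColex g.1).subtypeDomain _
  have hf : Function.Injective f := by
    rintro ⟨g, hg⟩ ⟨h, hh⟩ hgh
    refine Subtype.ext (ofColex.injective (Finsupp.ext fun i => ?_))
    rcases lt_or_ge (Ordinal.ToType.mk.symm i : Ordinal.{u}) α with hi | hi
    · exact DFunLike.congr_fun hgh ⟨i, hi⟩
    · exact (hg i hi).trans (hh i hi).symm
  have hα : #{i : κ.ord.ToType | (Ordinal.ToType.mk.symm i : Ordinal.{u}) < α} ≤ α.card := by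
    rw [← Cardinal.mk_toType]
    refine Cardinal.mk_le_of_injective
      (f := fun i => Ordinal.ToType.mk (⟨Ordinal.ToType.mk.symm i.1, i.2⟩ : Set.Iio α)) ?_
    intro i j hij
    have h := (Ordinal.ToType.mk (o := α)).injective hij
    exact Subtype.ext (Ordinal.ToType.mk.symm.injective (Subtype.ext (Subtype.mk.inj h)))
  refine (Cardinal.mk_le_of_injective hf).trans ?_
  cases isEmpty_or_nonempty {i : κ.ord.ToType | (Ordinal.ToType.mk.symm i : Ordinal.{u}) < α}
  · exact (Cardinal.mk_le_aleph0).trans (le_max_right _ _)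
  · rw [Cardinal.mk_finsupp_lift_of_infinite']
    simpa only [Cardinal.lift_id, Cardinal.lift_uzero, Cardinal.mk_int, Cardinal.lift_aleph0] using
      max_le_max_right ℵ₀ hα

/-- Continuity of the filtration at limits: only finitely many indices occur in a quotient of series
of finite support. -/
theorem exists_lt_mem_monomialField_exponentsBelow {α : Ordinal.{u}} (hα : Order.IsSuccLimit α)
    {x : HahnSeries (ExponentGroup κ) ℚ} (hx : x ∈ monomialField (exponentsBelow α)) :
    ∃ β < α, x ∈ monomialField (exponentsBelow β) := by
  obtain ⟨p, hp, q, hq, rfl⟩ := exists_div_of_mem_monomialField hx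
  let I : Finset κ.ord.ToType :=
    (hp.1.toFinset ∪ hq.1.toFinset).biUnion fun g => (ofColex g).support
  refine ⟨I.sup fun i => Order.succ (Ordinal.ToType.mk.symm i : Ordinal.{u}), ?_, ?_⟩
  · refine (Finset.sup_lt_iff hα.bot_lt).2 fun i hi => hα.succ_lt (lt_of_not_ge fun hαi => ?_)
    obtain ⟨g, hg, hgi⟩ := Finset.mem_biUnion.1 hi
    refine Finsupp.mem_support_iff.1 hgi ?_
    rcases Finset.mem_union.1 hg with h | h
    · exact hp.2 (hp.1.mem_toFinset.1 h) i hαi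
    · exact hq.2 (hq.1.mem_toFinset.1 h) i hαi
  · have key {g : ExponentGroup κ} (hg : g ∈ hp.1.toFinset ∪ hq.1.toFinset) :
        g ∈ exponentsBelow
          (I.sup fun i => Order.succ (Ordinal.ToType.mk.symm i : Ordinal.{u})) := by
      intro i hi
      by_contra h
      have hiI : i ∈ I := Finset.mem_biUnion.2 ⟨g, hg, Finsupp.mem_support_iff.2 h⟩
      exact ((Order.lt_succ _).trans_le (Finset.le_sup
        (f := fun i => Order.succ (Ordinal.ToType.mk.symm i : Ordinal.{u})) hiI)).not_ge hi
    exact div_mem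
      (finiteSupportSubring_le_monomialField _ ⟨hp.1, fun g hg => key (by simp_all)⟩)
      (finiteSupportSubring_le_monomialField _ ⟨hq.1, fun g hg => key (by simp_all)⟩)

end Exponents

/-! ### The field of rational functions in `κ` variables -/

section Example

variable {κ : Cardinal.{u}}

theorem mk_level_exponentsBelow_lt (hκ' : ℵ₀ < κ) {α : Ordinal.{u}} (hα : α < κ.ord) :
    #(level (exponentsBelow (κ := κ) α)) < κ :=
  (mk_level_le _).trans_lt (max_lt
    ((mk_exponentsBelow_le α).trans_lt (max_lt (Cardinal.lt_ord.1 hα) hκ')) hκ')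

theorem exists_lt_ord_mem_level (hκ : ℵ₀ ≤ κ) (x : orderedMonomialField (ExponentGroup κ)) :
    ∃ α < κ.ord, x ∈ level (exponentsBelow α) :=
  exists_lt_mem_monomialField_exponentsBelow (Cardinal.isSuccLimit_ord hκ)
    (by rw [exponentsBelow_ord]; exact x.2)

theorem mk_orderedMonomialField_le (hκ : ℵ₀ ≤ κ) :
    #(orderedMonomialField (ExponentGroup κ)) ≤ κ := by
  have h := (mk_level_le (exponentsBelow (κ := κ) κ.ord)).trans
    (max_le_max_right _ (mk_exponentsBelow_le κ.ord))
  have huniv : level (exponentsBelow (κ := κ) κ.ord) = Set.univ := by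
    rw [exponentsBelow_ord]
    exact Set.eq_univ_of_forall fun x => x.2
  rw [huniv, Cardinal.mk_univ, Cardinal.card_ord] at h
  simpa [hκ] using h

/-- A set of fewer than `κ` elements is contained in some `level (exponentsBelow α)` with `α < κ`,
which is bounded by the generator with index `α`. -/
theorem le_cof_orderedMonomialField (hκ : κ.IsRegular) :
    κ ≤ Order.cof (orderedMonomialField (ExponentGroup κ)) := by
  refine Order.le_cof_iff.2 fun S hS => ?_
  by_contra! hlt
  choose a ha hxa using exists_lt_ord_mem_level (κ := κ) hκ.aleph0_le
  have hsup : ⨆ s : S, a s < κ.ord :=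
    Ordinal.iSup_lt_of_lt_cof (by rwa [hκ.cof_ord]) fun s => ha s
  obtain ⟨g, hg⟩ := exists_forall_mem_exponentsBelow_lt hsup
  obtain ⟨t, ht⟩ := exists_forall_mem_level_lt hg
  obtain ⟨s, hs, hts⟩ := hS t
  refine hts.not_gt (ht s (monomialField_mono (exponentsBelow_mono ?_) (hxa s)))
  exact Ordinal.le_iSup (fun s : S => a s) ⟨s, hs⟩

theorem exists_orderedField_bolzanoWeierstrass (hκ : κ.IsRegular) (hκ' : ℵ₀ < κ) :
    ∃ (R : Type u) (_ : Field R) (_ : LinearOrder R) (_ : IsStrictOrderedRing R)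
      (_ : TopologicalSpace R) (_ : OrderTopology R),
      #R = κ ∧ Order.cof R = κ ∧ BolzanoWeierstrassProperty κ R ∧
        BoundedValueProperty R ∧ ¬ Archimedean R ∧ ¬ DedekindComplete R := by
  let _ : TopologicalSpace (orderedMonomialField (ExponentGroup κ)) := Preorder.topology _
  have : OrderTopology (orderedMonomialField (ExponentGroup κ)) := ⟨rfl⟩
  have hcof : Order.cof (orderedMonomialField (ExponentGroup κ)) = κ :=
    le_antisymm ((Order.cof_le_cardinalMk _).trans (mk_orderedMonomialField_le hκ.aleph0_le))
      (le_cof_orderedMonomialField hκ)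
  have hBW : BolzanoWeierstrassProperty κ (orderedMonomialField (ExponentGroup κ)) :=
    bolzanoWeierstrassProperty_of_filtration hκ hκ' (fun α => level (exponentsBelow α))
      (fun _ _ h _ hx => monomialField_mono (exponentsBelow_mono h) hx)
      (exists_lt_ord_mem_level hκ.aleph0_le) (fun _ => mk_level_exponentsBelow_lt hκ')
      (fun _ hα _ => exists_lt_mem_monomialField_exponentsBelow hα)
      (fun α _ hM _ => exists_mem_level_forall_abs_sub_lt (ordConnected_exponentsBelow α) hM)
  have harch : ¬ Archimedean (orderedMonomialField (ExponentGroup κ)) :=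
    not_archimedean_of_aleph0_lt_cof (by rwa [hcof])
  exact ⟨orderedMonomialField (ExponentGroup κ), inferInstance, inferInstance, inferInstance,
    inferInstance, inferInstance,
    le_antisymm (mk_orderedMonomialField_le hκ.aleph0_le)
      (hcof.symm.le.trans (Order.cof_le_cardinalMk _)), hcof, hBW,
    boundedValueProperty_of_bolzanoWeierstrassProperty hκ.aleph0_le hcof hBW, harch,
    not_dedekindComplete_of_not_archimedean harch⟩

end Example

end OrderedFieldAnalysis

theorem mainTheorem8 :
    -- the `κ`-Bolzano-Weierstrass Property implies the Bounded Value Property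
    (∀ (κ : Cardinal.{u}), κ.IsRegular →
      ∀ (R : Type u) [Field R] [LinearOrder R] [IsStrictOrderedRing R]
        [TopologicalSpace R] [OrderTopology R],
        Order.cof R = κ → OrderedFieldAnalysis.BolzanoWeierstrassProperty κ R →
          OrderedFieldAnalysis.BoundedValueProperty R) ∧
    -- such fields exist for every uncountable regular `κ`, and they are counterexamples
    (∀ (κ : Cardinal.{u}), κ.IsRegular → ℵ₀ < κ →
      ∃ (R : Type u) (_ : Field R) (_ : LinearOrder R) (_ : IsStrictOrderedRing R)
        (_ : TopologicalSpace R) (_ : OrderTopology R),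
        #R = κ ∧ Order.cof R = κ ∧ OrderedFieldAnalysis.BolzanoWeierstrassProperty κ R ∧
          OrderedFieldAnalysis.BoundedValueProperty R ∧ ¬ Archimedean R ∧
          ¬ OrderedFieldAnalysis.DedekindComplete R) ∧
    -- in particular, the Bounded Value Property does not imply completeness
    (∃ (R : Type u) (_ : Field R) (_ : LinearOrder R) (_ : IsStrictOrderedRing R)
        (_ : TopologicalSpace R) (_ : OrderTopology R),
        Order.cof R = ℵ₁ ∧ OrderedFieldAnalysis.BolzanoWeierstrassProperty ℵ₁ R ∧
          OrderedFieldAnalysis.BoundedValueProperty R ∧ ¬ Archimedean R ∧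
          ¬ OrderedFieldAnalysis.DedekindComplete R) := by
  refine ⟨fun κ hκ R _ _ _ _ _ hR hBW =>
      OrderedFieldAnalysis.boundedValueProperty_of_bolzanoWeierstrassProperty hκ.aleph0_le hR hBW,
    fun κ hκ hκ' => OrderedFieldAnalysis.exists_orderedField_bolzanoWeierstrass hκ hκ', ?_⟩
  obtain ⟨R, i₁, i₂, i₃, i₄, i₅, -, h⟩ :=
    OrderedFieldAnalysis.exists_orderedField_bolzanoWeierstrass.{u} isRegular_aleph_one
      aleph0_lt_aleph_one
  exact ⟨R, i₁, i₂, i₃, i₄, i₅, h⟩
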